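/- An oriented matroid $\mathcal M=(E,\mathcal C)$ on a finite ground set $E$ is given by its set $\mathcal C\subseteq\{+,-,0\}^E$ of signed circuits, and is assumed to be simple, i.e. every circuit has at least three nonzero entries. Its rank is the size of a largest subset of $E$ that contains no circuit (i.e. the support of no circuit). For $R\subseteq E$ let ${}_{-R}\mathcal M$ be the oriented matroid obtained by reversing the sign of $X_e$ for all $X\in\mathcal C$ and $e\in R$. For an integer $k\ge 0$, $\mathcal M$ is $k$-neighborly if every circuit of $\mathcal M$ has more than $k$ positive and more than $k$ negative entries, and a set $R\subseteq E$ is a $k$-neighborly reorientation of $\mathcal M$ if ${}_{-R}\mathcal M$ is $k$-neighborly. Let $f(r,n,k)$ be the maximum number of $k$-neighborly reorientations $R\subseteq E$ over all simple oriented matroids of rank $r$ on $n$ elements. Then for all integers $k,r,n$ with $r\ge 2k+2\ge 4$ and $n\ge r+1$, $$f(r,n,k)\le F(r,n,k),\qquad F(r,n,k)=\frac{2\left((n-r)+\binom{r}{k+1}+2^{r-1}\right)^{r-1-2k}}{(r-1-2k)!}.$$ -/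

import Mathlib

/-- An oriented matroid on the ground set `E`, given by its signed circuits
(sign vectors `X : E → SignType`, i.e. with values in `{1, 0, -1}`). -/
structure OrientedMatroid (E : Type*) where
  /-- The set of signed circuits. -/
  circuits : Set (E → SignType)
  /-- The zero vector is not a circuit. -/
  zero_notMem : (0 : E → SignType) ∉ circuits
  /-- The negative of a circuit is a circuit. -/
  neg_mem : ∀ X ∈ circuits, -X ∈ circuits
  /-- Incomparability: nested supports force equality up to sign. -/
  eq_or_eq_neg : ∀ X ∈ circuits, ∀ Y ∈ circuits,
    (∀ e, X e ≠ 0 → Y e ≠ 0) → X = Y ∨ X = -Y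
  /-- Weak circuit elimination: an element `e` with opposite signs in `X ≠ -Y` can be eliminated by
  a circuit `Z` with `Z⁺ ⊆ (X⁺ ∪ Y⁺) \ {e}` and `Z⁻ ⊆ (X⁻ ∪ Y⁻) \ {e}`. -/
  elimination : ∀ X ∈ circuits, ∀ Y ∈ circuits, X ≠ -Y → ∀ e, X e = 1 → Y e = -1 →
    ∃ Z ∈ circuits, Z e = 0 ∧
      ∀ f, (Z f = 1 → X f = 1 ∨ Y f = 1) ∧ (Z f = -1 → X f = -1 ∨ Y f = -1)

namespace OrientedMatroid

/-- The sign vector obtained from `X` by reversing the signs of the elements of `R`. -/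
def signFlip {E : Type*} [DecidableEq E] (R : Finset E) (X : E → SignType) : E → SignType :=
  fun e => if e ∈ R then -X e else X e

theorem signFlip_signFlip {E : Type*} [DecidableEq E] (R : Finset E) (X : E → SignType) :
    signFlip R (signFlip R X) = X := by
  funext e
  by_cases h : e ∈ R <;> simp [signFlip, h]

theorem signFlip_neg {E : Type*} [DecidableEq E] (R : Finset E) (X : E → SignType) :
    signFlip R (-X) = -signFlip R X := by
  funext e
  by_cases h : e ∈ R <;> simp [signFlip, h]

theorem signFlip_zero {E : Type*} [DecidableEq E] (R : Finset E) :
    signFlip R (0 : E → SignType) = 0 := by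
  funext e
  simp [signFlip]

theorem signFlip_apply_ne_zero {E : Type*} [DecidableEq E] (R : Finset E) (X : E → SignType) (e : E) :
    signFlip R X e ≠ 0 ↔ X e ≠ 0 := by
  by_cases h : e ∈ R
  · simp only [signFlip, h, if_true]
    generalize X e = s
    revert s; decide
  · simp [signFlip, h]

/-- The reorientation of `R`: the sign of `X e` is reversed for every circuit `X` and every
`e ∈ R`. -/
def reorient {E : Type*} [DecidableEq E] (M : OrientedMatroid E) (R : Finset E) :
    OrientedMatroid E where
  circuits := signFlip R '' M.circuits
  zero_notMem := by
    rintro ⟨X, hX, h⟩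
    have h0 : X = 0 := by rw [← signFlip_signFlip R X, h, signFlip_zero]
    exact M.zero_notMem (h0 ▸ hX)
  neg_mem := by
    rintro _ ⟨X, hX, rfl⟩
    exact ⟨-X, M.neg_mem X hX, signFlip_neg R X⟩
  eq_or_eq_neg := by
    rintro _ ⟨X, hX, rfl⟩ _ ⟨Y, hY, rfl⟩ h
    rcases M.eq_or_eq_neg X hX Y hY
      (fun e he => (signFlip_apply_ne_zero R Y e).1 (h e ((signFlip_apply_ne_zero R X e).2 he)))
      with h' | h'
    · exact Or.inl (by rw [h'])
    · exact Or.inr (by rw [h', signFlip_neg])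
  elimination := by
    rintro _ ⟨X, hX, rfl⟩ _ ⟨Y, hY, rfl⟩ hne e hXe hYe
    have hne' : X ≠ -Y := fun h => hne (by rw [h, signFlip_neg])
    by_cases he : e ∈ R
    · have hX1 : X e = -1 := by
        simp only [signFlip, he, if_true] at hXe
        rw [← neg_neg (X e), hXe]
      have hY1 : Y e = 1 := by
        simp only [signFlip, he, if_true] at hYe
        exact neg_injective hYe
      obtain ⟨Z, hZ, hZe, hZf⟩ := M.elimination Y hY X hX
        (fun h => hne' (by rw [h, neg_neg])) e hY1 hX1
      refine ⟨signFlip R Z, ⟨Z, hZ, rfl⟩, by simp [signFlip, hZe], fun f => ?_⟩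
      have := hZf f
      by_cases hf : f ∈ R
      · simp only [signFlip, hf, if_true]
        revert this
        generalize X f = a; generalize Y f = b; generalize Z f = c
        revert a b c; decide
      · simp only [signFlip, hf, if_false]
        exact ⟨fun h => (this.1 h).symm, fun h => (this.2 h).symm⟩
    · have hX1 : X e = 1 := by simpa [signFlip, he] using hXe
      have hY1 : Y e = -1 := by simpa [signFlip, he] using hYe
      obtain ⟨Z, hZ, hZe, hZf⟩ := M.elimination X hX Y hY hne' e hX1 hY1
      refine ⟨signFlip R Z, ⟨Z, hZ, rfl⟩, by simp [signFlip, hZe], fun f => ?_⟩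
      have := hZf f
      by_cases hf : f ∈ R
      · simp only [signFlip, hf, if_true]
        revert this
        generalize X f = a; generalize Y f = b; generalize Z f = c
        revert a b c; decide
      · simpa only [signFlip, hf, if_false] using this

/-- The positive elements `X⁺` of a sign vector. -/
def posSet {E : Type*} [Fintype E] (X : E → SignType) : Finset E :=
  Finset.univ.filter (fun e => X e = 1)

/-- The negative elements `X⁻` of a sign vector. -/
def negSet {E : Type*} [Fintype E] (X : E → SignType) : Finset E :=
  Finset.univ.filter (fun e => X e = -1)

/-- The support of a sign vector. -/
def supp {E : Type*} [Fintype E] (X : E → SignType) : Finset E :=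
  Finset.univ.filter (fun e => X e ≠ 0)

/-- `M` is simple if all its circuits have size at least three. -/
def IsSimple {E : Type*} [Fintype E] (M : OrientedMatroid E) : Prop :=
  ∀ X ∈ M.circuits, 3 ≤ (supp X).card

/-- `S` is independent if it contains no circuit (i.e. the support of none). -/
def Indep {E : Type*} [Fintype E] (M : OrientedMatroid E) (S : Finset E) : Prop :=
  ∀ X ∈ M.circuits, ¬ supp X ⊆ S

/-- The rank: the size of a largest set not containing a circuit. -/
noncomputable def rank {E : Type*} [Fintype E] (M : OrientedMatroid E) : ℕ :=
  sSup {m : ℕ | ∃ S : Finset E, M.Indep S ∧ S.card = m}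

/-- The supremum in the definition of the rank is a maximum. -/
theorem isGreatest_rank {E : Type*} [Fintype E] (M : OrientedMatroid E) :
    IsGreatest {m : ℕ | ∃ S : Finset E, M.Indep S ∧ S.card = m} M.rank := by
  have hb : BddAbove {m : ℕ | ∃ S : Finset E, M.Indep S ∧ S.card = m} := by
    refine ⟨Fintype.card E, ?_⟩
    rintro _ ⟨S, -, rfl⟩
    exact Finset.card_le_univ S
  refine ⟨Nat.sSup_mem ⟨0, ∅, fun X hX h => M.zero_notMem ?_, rfl⟩ hb, fun m hm => le_csSup hb hm⟩
  have h0 : X = 0 := by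
    funext e
    by_contra he
    exact absurd (h (Finset.mem_filter.2 ⟨Finset.mem_univ e, he⟩)) (Finset.notMem_empty e)
  exact h0 ▸ hX

/-- `M` is `k`-neighborly if every circuit has more than `k` positive and more than `k` negative
elements. -/
def IsNeighborly {E : Type*} [Fintype E] (M : OrientedMatroid E) (k : ℕ) : Prop :=
  ∀ X ∈ M.circuits, k < (posSet X).card ∧ k < (negSet X).card

/-- The number of `k`-neighborly reorientations of `M`, i.e. of subsets `R` of the ground set such
that the reorientation of `R` is `k`-neighborly. -/
noncomputable def numNeighborlyReorientations {E : Type*} [Fintype E] [DecidableEq E]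
    (M : OrientedMatroid E) (k : ℕ) : ℕ :=
  Set.ncard {R : Finset E | (M.reorient R).IsNeighborly k}

/-- The maximum number `f(r, n, k)` of `k`-neighborly reorientations over all (simple) oriented
matroids of rank `r` on `n` elements. -/
noncomputable def maxNeighborlyReorientations (r n k : ℕ) : ℕ :=
  sSup {m : ℕ | ∃ M : OrientedMatroid (Fin n),
    M.IsSimple ∧ M.rank = r ∧ M.numNeighborlyReorientations k = m}

theorem bddAbove_numNeighborlyReorientations (r n k : ℕ) :
    BddAbove {m : ℕ | ∃ M : OrientedMatroid (Fin n),
      M.IsSimple ∧ M.rank = r ∧ M.numNeighborlyReorientations k = m} := by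
  refine ⟨Fintype.card (Finset (Fin n)), ?_⟩
  rintro _ ⟨M, -, -, rfl⟩
  rw [← Nat.card_eq_fintype_card, ← Set.ncard_univ]
  exact Set.ncard_le_ncard (Set.subset_univ _) Set.finite_univ

/-- The supremum in the definition of `f(r, n, k)` is an upper bound. -/
theorem le_maxNeighborlyReorientations {n : ℕ} (M : OrientedMatroid (Fin n)) (hM : M.IsSimple)
    (k : ℕ) : M.numNeighborlyReorientations k ≤ maxNeighborlyReorientations M.rank n k :=
  le_csSup (bddAbove_numNeighborlyReorientations M.rank n k) ⟨M, hM, rfl, rfl⟩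

/-- The bound
`F(r, n, k) = 2 ((n - r) + C(r, k + 1) + 2 ^ (r - 1)) ^ (r - 1 - 2 k) / (r - 1 - 2 k)!`,
meant for `2 k + 2 ≤ r ≤ n`. -/
noncomputable def boundF (r n k : ℕ) : ℝ :=
  2 * (((n : ℝ) - (r : ℝ)) + (Nat.choose r (k + 1) : ℝ) + 2 ^ (r - 1)) ^ (r - 1 - 2 * k)
    / (Nat.factorial (r - 1 - 2 * k) : ℝ)

end OrientedMatroid

/-! Deleting an element `e` from neighborly sets gives a deletion-contraction recursion. Every
neighborly `R` restricts to a neighborly set of the deletion of `e`. If both extensions of a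
restriction, with and without `e`, are neighborly, then `e` is needed for neither sign count, so the
restriction is neighborly for the contraction as well. Hence `N(r, n + 1) ≤ N(r, n) + N(r - 1, n)`
for the maximal counts.

The recursion stops at rank `2k + 1`. There every `2k + 2` elements carry a vector with exactly `k +
1` entries of each sign, so the product of its signs is prescribed. On at least `2k + 3` elements
this parity leaves at most a set and its complement; on `2k + 2` elements there are at most `C(2k +
2, k + 1)` sets. For `r = n` the trivial bound `2 ^ r` serves. `boundF` dominates all these data:
`boundF_add_boundF_le` is the recursion, `two_pow_le_boundF` the diagonal.

The count is made for arbitrary families of sign vectors on a finite set `A`: contraction then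
merely forgets the coordinate `e`, with no passage to minimal supports. -/

namespace OrientedMatroid

open Finset

/-! ### Deletion and contraction for families of sign vectors -/

section NeighborlySets

variable {α : Type*} [DecidableEq α]

/-- All subsets `R` of `A` such that every sign vector in `V`, after reversing the signs on `R`, has
more than `k` positive and more than `k` negative entries in `A`. -/
noncomputable def neighborlySets (k : ℕ) (A : Finset α) (V : Set (α → SignType)) :
    Finset (Finset α) :=
  open Classical in
  A.powerset.filter fun R => ∀ X ∈ V,
    k < #{e ∈ A | signFlip R X e = 1} ∧ k < #{e ∈ A | signFlip R X e = -1}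

/-- Every `(r + 1)`-subset of `A` contains the support (within `A`) of a member of `V`. -/
def RankLE (A : Finset α) (V : Set (α → SignType)) (r : ℕ) : Prop :=
  ∀ S ⊆ A, #S = r + 1 → ∃ X ∈ V, ∀ e ∈ A, X e ≠ 0 → e ∈ S

theorem mem_neighborlySets {k : ℕ} {A : Finset α} {V : Set (α → SignType)} {R : Finset α} :
    R ∈ neighborlySets k A V ↔ R ⊆ A ∧ ∀ X ∈ V,
      k < #{e ∈ A | signFlip R X e = 1} ∧ k < #{e ∈ A | signFlip R X e = -1} := by
  classical
  simp [neighborlySets]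

theorem card_neighborlySets_le_two_pow (k : ℕ) (A : Finset α) (V : Set (α → SignType)) :
    #(neighborlySets k A V) ≤ 2 ^ #A := by
  classical
  rw [← card_powerset]
  exact card_filter_le _ _

theorem RankLE.deletion {A : Finset α} {V : Set (α → SignType)} {r : ℕ} (h : RankLE A V r)
    {e : α} (he : e ∈ A) : RankLE (A.erase e) {X ∈ V | X e = 0} r := by
  intro S hS hc
  obtain ⟨X, hX, hXS⟩ := h S (hS.trans (erase_subset _ _)) hc
  refine ⟨X, ⟨hX, ?_⟩, fun f hf => hXS f (mem_of_mem_erase hf)⟩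
  by_contra hne
  exact notMem_erase e A (hS (hXS e he hne))

/-- The family stays the same because only entries inside the ground set count. A vector supported
in `insert e S` has its remaining support in `S`. -/
theorem RankLE.contraction {A : Finset α} {V : Set (α → SignType)} {r : ℕ}
    (h : RankLE A V (r + 1)) {e : α} (he : e ∈ A) : RankLE (A.erase e) V r := by
  intro S hS hc
  have heS : e ∉ S := fun h' => notMem_erase e A (hS h')
  obtain ⟨X, hX, hXS⟩ := h (insert e S)
    (insert_subset he (hS.trans (erase_subset _ _))) (by rw [card_insert_of_notMem heS, hc])
  exact ⟨X, hX, fun f hf hne =>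
    mem_of_mem_insert_of_ne (hXS f (mem_of_mem_erase hf) hne) (ne_of_mem_erase hf)⟩

theorem signFlip_insert_of_ne (R : Finset α) (X : α → SignType) {e f : α} (h : f ≠ e) :
    signFlip (insert e R) X f = signFlip R X f := by
  simp [signFlip, h]

theorem signFlip_apply_eq_mul (R : Finset α) (X : α → SignType) (e : α) :
    signFlip R X e = (if e ∈ R then -1 else 1) * X e := by
  by_cases h : e ∈ R <;> simp [signFlip, h]

theorem mem_iff_of_signFlip_eq {R R' : Finset α} {X : α → SignType} {e : α} (hX : X e ≠ 0)
    (h : signFlip R X e = signFlip R' X e) : e ∈ R ↔ e ∈ R' := by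
  revert h hX
  by_cases h1 : e ∈ R <;> by_cases h2 : e ∈ R' <;> simp only [signFlip, h1, h2, if_true, if_false]
    <;> generalize X e = s <;> revert s <;> decide

theorem card_filter_erase_eq (A : Finset α) {e : α} {Y Z : α → SignType} {s : SignType}
    (h : ∀ f, f ≠ e → Y f = Z f) (he : Y e ≠ s) :
    #{f ∈ A | Y f = s} = #{f ∈ A.erase e | Z f = s} := by
  congr 1
  ext f
  by_cases hf : f = e
  · subst hf; simp [he]
  · simp [hf, h f hf]

theorem lt_card_filter_erase (A : Finset α) (e : α) {Y Z : α → SignType} {s : SignType}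
    (h : ∀ f, f ≠ e → Y f = Z f) (he : Y e ≠ s) {k : ℕ} (hk : k < #{f ∈ A | Y f = s}) :
    k < #{f ∈ A.erase e | Z f = s} := by
  rwa [← card_filter_erase_eq A h he]

/-- The deletion-contraction inequality. -/
theorem card_neighborlySets_le_deletion_add_contraction (k : ℕ) {A : Finset α}
    (V : Set (α → SignType)) (e : α) :
    #(neighborlySets k A V) ≤
      #(neighborlySets k (A.erase e) {X ∈ V | X e = 0}) + #(neighborlySets k (A.erase e) V) := by
  classical
  -- Both subfamilies are viewed as families on `A.erase e`: their union embeds in the deletion,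
  -- their intersection in the contraction.
  rw [← card_memberSubfamily_add_card_nonMemberSubfamily e (neighborlySets k A V),
    ← card_union_add_card_inter]
  refine add_le_add (card_le_card ?_) (card_le_card ?_)
  · intro R hR
    have hflip : ∀ R' X, (R' = R ∨ R' = insert e R) → ∀ f, f ≠ e →
        signFlip R' X f = signFlip R X f := by
      rintro R' X (rfl | rfl) f hf
      · rfl
      · exact signFlip_insert_of_ne R X hf
    obtain ⟨R', hR', hmem, heR⟩ : ∃ R', (R' = R ∨ R' = insert e R) ∧
        R' ∈ neighborlySets k A V ∧ e ∉ R := by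
      rcases mem_union.1 hR with h | h
      · rw [mem_memberSubfamily] at h
        exact ⟨_, Or.inr rfl, h⟩
      · rw [mem_nonMemberSubfamily] at h
        exact ⟨_, Or.inl rfl, h⟩
    rw [mem_neighborlySets] at hmem ⊢
    refine ⟨?_, ?_⟩
    · rw [subset_erase]
      refine ⟨?_, heR⟩
      rcases hR' with rfl | rfl
      · exact hmem.1
      · exact (subset_insert _ _).trans hmem.1
    · rintro X ⟨hX, hXe⟩
      have h0 : signFlip R' X e = 0 := by
        by_contra h
        exact (signFlip_apply_ne_zero R' X e).1 h hXe
      obtain ⟨h1, h2⟩ := hmem.2 X hX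
      exact ⟨lt_card_filter_erase A e (hflip R' X hR') (by rw [h0]; decide) h1,
        lt_card_filter_erase A e (hflip R' X hR') (by rw [h0]; decide) h2⟩
  · intro R hR
    rw [mem_inter, mem_memberSubfamily, mem_nonMemberSubfamily] at hR
    obtain ⟨⟨h1, heR⟩, h2, -⟩ := hR
    rw [mem_neighborlySets] at h1 h2 ⊢
    refine ⟨subset_erase.2 ⟨h2.1, heR⟩, fun X hX => ?_⟩
    -- The entry at `e` has opposite values under `R` and `insert e R`, so for at least one of them
    -- it is not `s`, and that count lives entirely off `e`.
    have key : ∀ s : SignType, s ≠ 0 → k < #{f ∈ A | signFlip (insert e R) X f = s} →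
        k < #{f ∈ A | signFlip R X f = s} → k < #{f ∈ A.erase e | signFlip R X f = s} := by
      intro s hs ha hb
      by_cases h : signFlip R X e = s
      · refine lt_card_filter_erase A e (fun f => signFlip_insert_of_ne R X) ?_ ha
        have hi : signFlip (insert e R) X e = -s := by
          rw [← h]; simp [signFlip, heR]
        rw [hi, ne_eq, SignType.neg_eq_self_iff]
        exact hs
      · exact lt_card_filter_erase A e (fun _ _ => rfl) h hb
    exact ⟨key 1 (by decide) (h1.2 X hX).1 (h2.2 X hX).1,
      key (-1) (by decide) (h1.2 X hX).2 (h2.2 X hX).2⟩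

/-! ### Rank `2k + 1`: balanced vectors and parity -/

/-- A vector with more than `k` entries of each sign supported on `2 k + 2` elements is balanced. -/
theorem balanced_of_mem_neighborlySets {k : ℕ} {A S R : Finset α} {V : Set (α → SignType)}
    {X : α → SignType} (hR : R ∈ neighborlySets k A V) (hX : X ∈ V) (hSA : S ⊆ A)
    (hXS : ∀ e ∈ A, X e ≠ 0 → e ∈ S) (hS : #S = 2 * k + 2) :
    (∀ e ∈ S, X e ≠ 0) ∧ #{e ∈ S | signFlip R X e = 1} = k + 1 ∧
      ∏ e ∈ S, signFlip R X e = (-1) ^ (k + 1) := by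
  classical
  obtain ⟨h1, h2⟩ := (mem_neighborlySets.1 hR).2 X hX
  have hfil : ∀ s : SignType, s ≠ 0 →
      ({e ∈ A | signFlip R X e = s} : Finset α) = {e ∈ S | signFlip R X e = s} := by
    intro s hs
    ext e
    simp only [mem_filter]
    exact ⟨fun h => ⟨hXS e h.1 ((signFlip_apply_ne_zero R X e).1 (by rw [h.2]; exact hs)), h.2⟩,
      fun h => ⟨hSA h.1, h.2⟩⟩
  rw [hfil 1 (by decide)] at h1
  rw [hfil (-1) (by decide)] at h2
  have hdis : Disjoint ({e ∈ S | signFlip R X e = 1} : Finset α)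
      {e ∈ S | signFlip R X e = -1} := by
    rw [disjoint_filter]
    intro e _ h h'
    rw [h] at h'
    exact absurd h' (by decide)
  have hsub : ({e ∈ S | signFlip R X e = 1} : Finset α) ∪ {e ∈ S | signFlip R X e = -1} ⊆ S :=
    union_subset (filter_subset _ _) (filter_subset _ _)
  have hcard := card_le_card hsub
  rw [card_union_of_disjoint hdis, hS] at hcard
  -- Two disjoint parts of size at least `k + 1` exhaust a set of size `2k + 2`.
  have hun := eq_of_subset_of_card_le hsub (by rw [card_union_of_disjoint hdis]; omega)
  refine ⟨fun e he => ?_, by omega, ?_⟩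
  · rw [← hun, mem_union, mem_filter, mem_filter] at he
    rw [← signFlip_apply_ne_zero R]
    rcases he with h | h <;> rw [h.2] <;> decide
  · rw [← hun, prod_union hdis, prod_congr rfl (g := fun _ => 1) (fun e he => (mem_filter.1 he).2),
      prod_const_one, one_mul,
      prod_congr rfl (g := fun _ => -1) (fun e he => (mem_filter.1 he).2), prod_const]
    congr 1
    omega

/-- Some `X` in the family is nonzero on all of `A`, so `R` can be recovered from the positive part
of the flipped `X`, a `(k + 1)`-subset of `A`. -/
theorem card_neighborlySets_le_choose {k : ℕ} {A : Finset α} {V : Set (α → SignType)}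
    (h : RankLE A V (2 * k + 1)) (hA : #A = 2 * k + 2) :
    #(neighborlySets k A V) ≤ (2 * k + 2).choose (k + 1) := by
  classical
  obtain ⟨X, hX, hXA⟩ := h A Subset.rfl hA
  rw [← hA, ← card_powersetCard]
  refine card_le_card_of_injOn (fun R => {e ∈ A | signFlip R X e = 1}) ?_ ?_
  · intro R hR
    exact mem_coe.2 (mem_powersetCard.2 ⟨filter_subset _ _,
      (balanced_of_mem_neighborlySets hR hX Subset.rfl hXA hA).2.1⟩)
  · intro R hR R' hR' hRR
    have hX0 := (balanced_of_mem_neighborlySets hR hX Subset.rfl hXA hA).1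
    ext e
    by_cases he : e ∈ A
    · refine mem_iff_of_signFlip_eq (hX0 e he) ?_
      have h1 : signFlip R X e = 1 ↔ signFlip R' X e = 1 := by
        simpa [he] using Finset.ext_iff.1 hRR e
      have h2 := hX0 e he
      revert h1 h2
      simp only [signFlip]
      by_cases a : e ∈ R <;> by_cases b : e ∈ R' <;> simp only [a, b, if_true, if_false] <;>
        generalize X e = s <;> revert s <;> decide
    · exact ⟨fun h' => absurd ((mem_neighborlySets.1 hR).1 h') he,
        fun h' => absurd ((mem_neighborlySets.1 hR').1 h') he⟩

/-- In odd rank, on sufficiently many elements, two neighborly reorientations agree or are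
complementary. -/
theorem mem_iff_mem_congr_of_neighborlySets {k : ℕ} {A : Finset α} {V : Set (α → SignType)}
    (h : RankLE A V (2 * k + 1)) (hA : 2 * k + 3 ≤ #A) {R R' : Finset α}
    (hR : R ∈ neighborlySets k A V) (hR' : R' ∈ neighborlySets k A V) {a b : α} (ha : a ∈ A)
    (hb : b ∈ A) : (a ∈ R ↔ a ∈ R') ↔ (b ∈ R ↔ b ∈ R') := by
  classical
  have hcard : 2 * k + 1 ≤ #((A.erase a).erase b) := by
    have h1 := pred_card_le_card_erase (s := A) (a := a)
    have h2 := pred_card_le_card_erase (s := A.erase a) (a := b)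
    omega
  obtain ⟨T, hT, hTc⟩ := exists_subset_card_eq hcard
  have hTA : T ⊆ A := hT.trans ((erase_subset _ _).trans (erase_subset _ _))
  have haT : a ∉ T := fun h' => by simpa using hT h'
  have hbT : b ∉ T := fun h' => by simpa using hT h'
  -- Both flips of a vector supported on `insert c T` have sign product `(-1) ^ (k + 1)`; its own
  -- entries cancel. Comparing `c = a` with `c = b` then eliminates `T`.
  have key : ∀ c ∈ A, c ∉ T →
      (if c ∈ R then (-1 : SignType) else 1) * ∏ e ∈ T, (if e ∈ R then (-1 : SignType) else 1) =
      (if c ∈ R' then (-1 : SignType) else 1) *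
        ∏ e ∈ T, (if e ∈ R' then (-1 : SignType) else 1) := by
    intro c hc hcT
    have hS : #(insert c T) = 2 * k + 2 := by rw [card_insert_of_notMem hcT, hTc]
    have hSA : insert c T ⊆ A := insert_subset hc hTA
    obtain ⟨X, hX, hXS⟩ := h _ hSA hS
    obtain ⟨hX0, -, h1⟩ := balanced_of_mem_neighborlySets hR hX hSA hXS hS
    obtain ⟨-, -, h2⟩ := balanced_of_mem_neighborlySets hR' hX hSA hXS hS
    simp only [signFlip_apply_eq_mul] at h1 h2
    rw [prod_mul_distrib] at h1 h2
    rw [← h2] at h1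
    have := mul_right_cancel₀ (prod_ne_zero_iff.2 hX0) h1
    rwa [prod_insert hcT, prod_insert hcT] at this
  have hne : ∀ Q : Finset α, ∏ e ∈ T, (if e ∈ Q then (-1 : SignType) else 1) ≠ 0 := by
    intro Q
    rw [prod_ne_zero_iff]
    intro e _
    split_ifs <;> decide
  have ka := key a ha haT
  have kb := key b hb hbT
  have n1 := hne R
  have n2 := hne R'
  revert ka kb n1 n2
  generalize ∏ e ∈ T, (if e ∈ R then (-1 : SignType) else 1) = u
  generalize ∏ e ∈ T, (if e ∈ R' then (-1 : SignType) else 1) = v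
  by_cases p : a ∈ R <;> by_cases q : a ∈ R' <;> by_cases x : b ∈ R <;> by_cases y : b ∈ R' <;>
    simp only [p, q, x, y, if_true, if_false] <;> revert u v <;> decide

theorem card_neighborlySets_le_two {k : ℕ} {A : Finset α} {V : Set (α → SignType)}
    (h : RankLE A V (2 * k + 1)) (hA : 2 * k + 3 ≤ #A) : #(neighborlySets k A V) ≤ 2 := by
  classical
  rcases (neighborlySets k A V).eq_empty_or_nonempty with h0 | ⟨R, hR⟩
  · simp [h0]
  · refine (card_le_card (t := {R, A \ R}) fun R' hR' => ?_).trans card_le_two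
    have hRA := (mem_neighborlySets.1 hR).1
    have hRA' := (mem_neighborlySets.1 hR').1
    obtain ⟨a, ha⟩ : A.Nonempty := card_pos.1 (by omega)
    have key := fun b hb => mem_iff_mem_congr_of_neighborlySets h hA hR hR' ha (b := b) hb
    rw [mem_insert, mem_singleton]
    by_cases hc : a ∈ R ↔ a ∈ R'
    · left
      ext b
      by_cases hb : b ∈ A
      · exact ((key b hb).1 hc).symm
      · exact ⟨fun h' => absurd (hRA' h') hb, fun h' => absurd (hRA h') hb⟩
    · right
      ext b
      by_cases hb : b ∈ A
      · have := (key b hb).not.1 hc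
        simp only [mem_sdiff, hb, true_and]
        tauto
      · exact ⟨fun h' => absurd (hRA' h') hb, fun h' => absurd (mem_sdiff.1 h').1 hb⟩

end NeighborlySets

/-! ### Estimates for the bound -/

theorem factorial_succ_le_pow (j : ℕ) : (j + 1).factorial ≤ (j + 1) ^ j := by
  have h := Nat.factorial_mul_descFactorial (Nat.le_succ j)
  rw [Nat.succ_eq_add_one, Nat.add_sub_cancel_left, Nat.factorial_one, one_mul] at h
  rw [← h]
  exact Nat.descFactorial_le_pow _ _

theorem pow_succ_add_mul_pow_le {x : ℝ} (hx : 0 ≤ x) (m : ℕ) :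
    x ^ (m + 1) + (m + 1) * x ^ m ≤ (x + 1) ^ (m + 1) := by
  induction m with
  | zero => simp
  | succ m ih =>
    have h1 := mul_le_mul_of_nonneg_right ih (by linarith : 0 ≤ x + 1)
    have h2 : (0 : ℝ) ≤ (m + 1) * x ^ m := by positivity
    rw [pow_succ (x + 1) (m + 1)]
    refine le_trans ?_ h1
    push_cast
    have h3 : (x ^ (m + 1) + (m + 1) * x ^ m) * (x + 1) =
        x ^ (m + 1 + 1) + (m + 1 + 1) * x ^ (m + 1) + (m + 1) * x ^ m := by ring
    linarith

theorem boundF_nonneg {r n k : ℕ} (hn : r ≤ n) : 0 ≤ boundF r n k := by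
  have : (r : ℝ) ≤ n := by exact_mod_cast hn
  have : (0 : ℝ) ≤ (n : ℝ) - r := by linarith
  unfold boundF
  positivity

/-- The base `z` of the power is at least `2 ^ (r - 1)`, hence at least `j + 1`. One factor `z` pays
for `2 ^ (r - 1)`, the other `j` for `(j + 1)!`. -/
theorem two_pow_le_boundF {r k : ℕ} (hr : 2 * k + 2 ≤ r) : (2 : ℝ) ^ r ≤ boundF r r k := by
  obtain ⟨j, rfl⟩ : ∃ j, r = j + 2 * k + 2 := ⟨r - (2 * k + 2), by omega⟩
  have hm : j + 2 * k + 1 - 2 * k = j + 1 := by omega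
  have hr1 : j + 2 * k + 2 - 1 = j + 2 * k + 1 := by omega
  simp only [boundF, hm, hr1, sub_self, zero_add]
  set c : ℝ := ((j + 2 * k + 2).choose (k + 1) : ℝ)
  have hc : 0 ≤ c := Nat.cast_nonneg _
  have hlt : j + 1 ≤ 2 ^ (j + 2 * k + 1) :=
    le_trans (by omega) (Nat.lt_two_pow_self (n := j + 2 * k + 1)).le
  have hlt' : ((j : ℝ) + 1) ≤ c + 2 ^ (j + 2 * k + 1) := by
    have : ((j : ℝ) + 1) ≤ 2 ^ (j + 2 * k + 1) := by exact_mod_cast hlt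
    linarith
  have hfac : ((j + 1).factorial : ℝ) ≤ (c + 2 ^ (j + 2 * k + 1)) ^ j := by
    have h : ((j + 1).factorial : ℝ) ≤ ((j : ℝ) + 1) ^ j := by
      exact_mod_cast factorial_succ_le_pow j
    exact h.trans (pow_le_pow_left₀ (by positivity) hlt' j)
  rw [le_div_iff₀ (by positivity), pow_succ (2 : ℝ) (j + 2 * k + 1), pow_succ (c + _) j]
  have h := mul_le_mul hfac (show (2 : ℝ) ^ (j + 2 * k + 1) ≤ c + 2 ^ (j + 2 * k + 1) by linarith)
    (by positivity) (by positivity)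
  linarith

/-- Let `m = r - 2k`, and let `x`, `y` be the bases of the powers for ranks `r + 1` and `r`. After
clearing `m!`, the claim is `x ^ m + m * y ^ (m - 1) ≤ (x + 1) ^ m`, which follows from `y ≤ x`: the
growth of the binomial coefficient makes up for the loss of one in `n - r`. -/
theorem boundF_add_boundF_le {r n k : ℕ} (hr : 2 * k + 2 ≤ r) (hn : r ≤ n) :
    boundF (r + 1) n k + boundF r n k ≤ boundF (r + 1) (n + 1) k := by
  obtain ⟨j, rfl⟩ : ∃ j, r = j + 2 * k + 2 := ⟨r - (2 * k + 2), by omega⟩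
  have hm : j + 2 * k + 1 - 2 * k = j + 1 := by omega
  have hm' : j + 2 * k + 1 + 1 - 2 * k = j + 1 + 1 := by omega
  have hr1 : j + 2 * k + 2 - 1 = j + 2 * k + 1 := by omega
  have hr1' : j + 2 * k + 2 + 1 - 1 = j + 2 * k + 1 + 1 := by omega
  simp only [boundF, hm, hm', hr1, hr1']
  have hchoose : (((j + 2 * k + 2).choose (k + 1) : ℕ) : ℝ) + 1 ≤
      ((j + 2 * k + 2 + 1).choose (k + 1) : ℕ) := by
    have : 0 < (j + 2 * k + 2).choose k := Nat.choose_pos (by omega)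
    rw [Nat.choose_succ_succ' (j + 2 * k + 2) k]
    exact_mod_cast (by omega)
  have hn' : (((j + 2 * k + 2 : ℕ)) : ℝ) ≤ n := by exact_mod_cast hn
  have hpow : (2 : ℝ) ^ (j + 2 * k + 1) ≤ 2 ^ (j + 2 * k + 1 + 1) :=
    pow_le_pow_right₀ (by norm_num) (by omega)
  set y : ℝ := (n : ℝ) - ((j + 2 * k + 2 : ℕ) : ℝ) + ((j + 2 * k + 2).choose (k + 1) : ℕ) +
    2 ^ (j + 2 * k + 1) with hy
  set x : ℝ := (n : ℝ) - ((j + 2 * k + 2 + 1 : ℕ) : ℝ) +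
    ((j + 2 * k + 2 + 1).choose (k + 1) : ℕ) + 2 ^ (j + 2 * k + 1 + 1) with hx
  have hyx : y ≤ x := by
    rw [hx, hy, Nat.cast_succ (j + 2 * k + 2)]
    linarith
  have hy0 : 0 ≤ y := by
    have : (0 : ℝ) ≤ n - ((j + 2 * k + 2 : ℕ) : ℝ) := by linarith
    positivity
  have hx1 : ((n + 1 : ℕ) : ℝ) - ((j + 2 * k + 2 + 1 : ℕ) : ℝ) +
      ((j + 2 * k + 2 + 1).choose (k + 1) : ℕ) + 2 ^ (j + 2 * k + 1 + 1) = x + 1 := by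
    rw [hx, Nat.cast_succ n]
    ring
  rw [hx1]
  have hf : ((j + 1 + 1).factorial : ℝ) = ((j + 1 : ℕ) + 1) * (j + 1).factorial := by
    rw [Nat.factorial_succ (j + 1)]
    push_cast
    ring
  have hstep := pow_succ_add_mul_pow_le (hy0.trans hyx) (j + 1)
  have hyx' : ((j + 1 : ℕ) + 1 : ℝ) * y ^ (j + 1) ≤ ((j + 1 : ℕ) + 1) * x ^ (j + 1) := by gcongr
  have hsplit : 2 * y ^ (j + 1) / ((j + 1).factorial : ℝ) =
      2 * (((j + 1 : ℕ) + 1) * y ^ (j + 1)) / ((j + 1 + 1).factorial : ℝ) := by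
    rw [hf]
    field_simp
  rw [hsplit, ← add_div]
  gcongr
  linarith

theorem boundF_two_mul_add_two (n k : ℕ) :
    boundF (2 * k + 2) n k = 2 * ((n : ℝ) - (2 * k + 2 : ℕ) +
      ((2 * k + 2).choose (k + 1) : ℝ) + 2 ^ (2 * k + 1)) := by
  have hm : 2 * k + 1 - 2 * k = 1 := by omega
  have hr1 : 2 * k + 2 - 1 = 2 * k + 1 := by omega
  simp only [boundF, hm, hr1, pow_one, Nat.factorial_one, Nat.cast_one, div_one]

/-! ### The induction and its application to circuits -/

theorem card_neighborlySets_le_boundF {α : Type*} [DecidableEq α] {k : ℕ} (n : ℕ) :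
    ∀ {r : ℕ} {A : Finset α} {V : Set (α → SignType)}, RankLE A V r → #A = n → 2 * k + 2 ≤ r →
      r ≤ n → (#(neighborlySets k A V) : ℝ) ≤ boundF r n k := by
  induction n with
  | zero => intros; omega
  | succ n ih =>
    intro r A V h hA hr hn
    have hpow := card_neighborlySets_le_two_pow k A V
    rcases hn.eq_or_lt with rfl | hlt
    · refine le_trans ?_ (two_pow_le_boundF hr)
      rw [hA] at hpow
      exact_mod_cast hpow
    obtain ⟨e, he⟩ : A.Nonempty := card_pos.1 (by omega)
    have hAe : #(A.erase e) = n := by rw [card_erase_of_mem he, hA, Nat.add_sub_cancel]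
    have hdc : (#(neighborlySets k A V) : ℝ) ≤
        #(neighborlySets k (A.erase e) {X ∈ V | X e = 0}) + #(neighborlySets k (A.erase e) V) := by
      exact_mod_cast card_neighborlySets_le_deletion_add_contraction k V e
    have hdel := ih (h.deletion he) hAe hr (by omega)
    obtain ⟨r, rfl⟩ : ∃ s, r = s + 1 := ⟨r - 1, by omega⟩
    have hcon := h.contraction he
    rcases (show 2 * k + 1 ≤ r by omega).eq_or_lt with rfl | hlt'
    · rw [show 2 * k + 1 + 1 = 2 * k + 2 from rfl, boundF_two_mul_add_two] at *
      -- The contraction has rank `2k + 1`. Normally it contributes at most 2, the slope of the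
      -- bound in `n`; only on `2k + 2` elements can it contribute the central binomial coefficient,
      -- which the bound includes.
      rcases (show 2 * k + 2 ≤ n by omega).eq_or_lt with rfl | hlt''
      · have h1 : (#(neighborlySets k (A.erase e) {X ∈ V | X e = 0}) : ℝ) ≤ 2 ^ (2 * k + 2) := by
          have := card_neighborlySets_le_two_pow k (A.erase e) {X ∈ V | X e = 0}
          rw [hAe] at this
          exact_mod_cast this
        have h2 : (#(neighborlySets k (A.erase e) V) : ℝ) ≤ (2 * k + 2).choose (k + 1) := by
          exact_mod_cast card_neighborlySets_le_choose hcon hAe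
        have h3 : (0 : ℝ) ≤ (2 * k + 2).choose (k + 1) := by positivity
        have h4 : (2 : ℝ) ^ (2 * k + 2) = 2 * 2 ^ (2 * k + 1) := by ring
        push_cast
        linarith
      · have h2 : (#(neighborlySets k (A.erase e) V) : ℝ) ≤ 2 := by
          exact_mod_cast card_neighborlySets_le_two hcon (by omega)
        push_cast at *
        linarith
    · have := ih hcon hAe hlt' (by omega)
      have := boundF_add_boundF_le (n := n) (show 2 * k + 2 ≤ r from hlt') (by omega)
      linarith

/-- Every subset of cardinality greater than the rank contains a circuit. -/
theorem rankLE_circuits {E : Type*} [Fintype E] [DecidableEq E] (M : OrientedMatroid E) :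
    RankLE univ M.circuits M.rank := by
  intro S _ hS
  have hdep : ¬ M.Indep S := fun h => by
    have := M.isGreatest_rank.2 ⟨S, h, rfl⟩
    omega
  simp only [Indep, not_forall, not_not] at hdep
  obtain ⟨X, hX, hXS⟩ := hdep
  exact ⟨X, hX, fun e _ hne => hXS (mem_filter.2 ⟨mem_univ e, hne⟩)⟩

theorem numNeighborlyReorientations_eq {E : Type*} [Fintype E] [DecidableEq E]
    (M : OrientedMatroid E) (k : ℕ) :
    M.numNeighborlyReorientations k = #(neighborlySets k univ M.circuits) := by
  rw [numNeighborlyReorientations, ← Set.ncard_coe_finset]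
  congr 1
  ext R
  simp [mem_neighborlySets, IsNeighborly, reorient, posSet, negSet]

end OrientedMatroid

theorem theorem3 (r n k : ℕ) (hk : 4 ≤ 2 * k + 2) (hr : 2 * k + 2 ≤ r) (hn : r + 1 ≤ n) :
    (OrientedMatroid.maxNeighborlyReorientations r n k : ℝ) ≤ OrientedMatroid.boundF r n k := by
  -- The floor moves the inequality to `ℕ`, where `csSup_le'` needs no nonemptiness since the empty
  -- supremum is 0.
  rw [← Nat.le_floor_iff (OrientedMatroid.boundF_nonneg (by omega))]
  refine csSup_le' ?_
  rintro _ ⟨M, -, rfl, rfl⟩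
  rw [Nat.le_floor_iff (OrientedMatroid.boundF_nonneg (by omega)),
    M.numNeighborlyReorientations_eq]
  exact OrientedMatroid.card_neighborlySets_le_boundF n M.rankLE_circuits (by simp) hr (by omega)
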